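/- Let $R$ be a ring, $\mathrm{Mod}(R)$ the category of right $R$-modules, $\mathrm{mod}(R^{op})$ the category of finitely presented left $R$-modules, and $(\mathrm{mod}(R^{op}),\mathrm{Ab})$ the abelian category of additive functors from it to abelian groups. Let $\mathrm{fp}(\mathrm{Mod}(R),\mathrm{Ab})$ be the abelian category of finitely presented functors, i.e. of functors $F$ admitting an exact sequence $(Y,-)\to(X,-)\to F\to 0$ with $X,Y$ in $\mathrm{Mod}(R)$, where $(X,-)=\mathrm{Hom}_R(X,-)$; its morphisms are the natural transformations. Consider the contravariant Yoneda embedding $\mathsf Y:\mathrm{Mod}(R)\to\mathrm{fp}(\mathrm{Mod}(R),\mathrm{Ab})$, $\mathsf Y(X)=(X,-)$; the contravariant functor $w:\mathrm{fp}(\mathrm{Mod}(R),\mathrm{Ab})\to\mathrm{Mod}(R)$ adjoint to it, $\mathrm{Hom}_R(X,w(F))\cong\mathrm{Nat}(F,(X,-))$; the functor $t:\mathrm{Mod}(R)\to(\mathrm{mod}(R^{op}),\mathrm{Ab})$, $t(X)=X\otimes_R-$; and the evaluation functor $\mathrm{ev}_R:(\mathrm{mod}(R^{op}),\mathrm{Ab})\to\mathrm{Mod}(R)$,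 $\mathrm{ev}_R(F)=F(R)$, where $r\in R$ acts on $F(R)$ by $F(-\cdot r)$. Define contravariant functors $$D_A:\mathrm{fp}(\mathrm{Mod}(R),\mathrm{Ab})\to(\mathrm{mod}(R^{op}),\mathrm{Ab}),\qquad D_L:(\mathrm{mod}(R^{op}),\mathrm{Ab})\to\mathrm{fp}(\mathrm{Mod}(R),\mathrm{Ab})$$ as follows. $D_A$ is the zeroth right derived functor of $t\circ w$: if $P_1\to P_0\to F\to 0$ is exact with $P_0,P_1$ projective, then $D_A(F)=\ker\bigl(tw(P_0)\to tw(P_1)\bigr)$. $D_L=L^0(\mathsf Y\circ\mathrm{ev}_R)$ is the zeroth left derived functor: if $0\to H\to I^0\to I^1$ is exact with $I^0,I^1$ injective, then $D_L(H)=\mathrm{coker}\bigl((I^1(R),-)\to(I^0(R),-)\bigr)$. Let $\ker(D_A)$ be the full subcategory of $\mathrm{fp}(\mathrm{Mod}(R),\mathrm{Ab})$ of the functors $F$ with $D_A(F)=0$, and $i$ its inclusion. For a module $X$ let $\gamma_{(X,-)}:D_LD_A(X,-)\to(X,-)$ be the component at $X\otimes_R-$ of the canonical natural transformation $L^0(\mathsf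 Y\circ\mathrm{ev}_R)\to\mathsf Y\circ\mathrm{ev}_R$, using the canonical isomorphisms $D_A(X,-)\cong X\otimes_R-$ and $X\cong X\otimes_R R$. For a presentation $(Y,-)\to(X,-)\xrightarrow{p}F\to0$ let $\gamma_F:D_LD_AF\to F$ be the map induced on cokernels by $\gamma_{(Y,-)}$ and $\gamma_{(X,-)}$, so that $\gamma_F\circ D_LD_A(p)=p\circ\gamma_{(X,-)}$; it does not depend on the presentation and is natural in $F$. Put $F^p=\mathrm{coker}(\gamma_F)$, with the maps between cokernels induced by natural transformations $F\to G$. **Proposition.** For every $F$ in $\mathrm{fp}(\mathrm{Mod}(R),\mathrm{Ab})$ the functor $F^p$ lies in $\ker(D_A)$, and the resulting functor $$(-)^p:\mathrm{fp}(\mathrm{Mod}(R),\mathrm{Ab})\to\ker(D_A),\qquad F\mapsto F^p,$$ is left adjoint to the inclusion $i:\ker(D_A)\to\mathrm{fp}(\mathrm{Mod}(R),\mathrm{Ab})$, with unit the projections $F\to F^p$: for $F$ in $\mathrm{fp}(\mathrm{Mod}(R),\mathrm{Ab})$ and $G$ in $\ker(D_A)$, composition with $F\to F^p$ gives an isomorphism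 $\mathrm{Nat}(F^p,G)\cong\mathrm{Nat}(F,G)$, natural in $F$ and $G$. -/

import Mathlib

open CategoryTheory CategoryTheory.Limits Opposite
open scoped TensorProduct ZeroObject

universe v u u'

namespace AGJ

section AdditiveFunctors

variable {J : Type*} [Category* J] [Preadditive J] {D : Type*} [Category* D] [Abelian D]

instance : (additiveFunctor J D).IsClosedUnderSubobjects where
  prop_of_mono {X Y} f _ hY := by
    have : Y.Additive := hY
    exact ⟨fun {a b g h} => by
      rw [← cancel_mono (f.app b)]
      simp [Functor.map_add]⟩

instance : (additiveFunctor J D).IsClosedUnderQuotients where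
  prop_of_epi {X Y} f _ hX := by
    have : X.Additive := hX
    exact ⟨fun {a b g h} => by
      rw [← cancel_epi (f.app a)]
      simp only [Preadditive.comp_add, ← NatTrans.naturality, Functor.map_add,
        Preadditive.add_comp]⟩

instance (K : Type*) [Category* K] [HasLimitsOfShape K D] :
    (additiveFunctor J D).IsClosedUnderLimitsOfShape K where
  limitsOfShape_le := by
    rintro X ⟨p⟩
    refine ⟨fun {a b g h} => ?_⟩
    refine (isLimitOfPreserves ((evaluation J D).obj b) p.isLimit).hom_ext fun k => ?_
    have := p.prop_diag_obj k
    have : (p.diag.obj k).Additive := this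
    simp [Functor.map_add]

instance : (additiveFunctor J D).IsClosedUnderFiniteProducts where
  isClosedUnderLimitsOfShape _ _ := inferInstance

instance : (additiveFunctor J D).ContainsZero where
  exists_zero := ⟨(Functor.const J).obj 0, Functor.isZero _ fun _ => isZero_zero _,
    ⟨fun {_ _ _ _} => (isZero_zero D).eq_of_src _ _⟩⟩

noncomputable instance : Abelian (J ⥤+ D) := inferInstance

end AdditiveFunctors

section Injectives

variable {J : Type*} [Category.{v} J] [Preadditive J]

/-- The additive functor `l ↦ Hom_ℤ(Hom(l, j), D)`. -/
def coind (j : J) (D : AddCommGrpCat.{v}) : J ⥤+ AddCommGrpCat.{v} :=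
  ⟨{ obj := fun l => AddCommGrpCat.of ((l ⟶ j) →+ D)
     map := fun f => AddCommGrpCat.ofHom
      { toFun := fun φ => φ.comp (Preadditive.leftComp j f)
        map_zero' := rfl
        map_add' := fun _ _ => rfl }
     map_id := fun _ => AddCommGrpCat.hom_ext <| AddMonoidHom.ext fun φ =>
      AddMonoidHom.ext fun h => congrArg φ (Category.id_comp h)
     map_comp := fun f g => AddCommGrpCat.hom_ext <| AddMonoidHom.ext fun φ =>
      AddMonoidHom.ext fun h => congrArg φ (Category.assoc f g h) }, ⟨fun {_ _ f g} =>
        AddCommGrpCat.hom_ext <| AddMonoidHom.ext fun φ => AddMonoidHom.ext fun h =>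
          (congrArg φ (Preadditive.add_comp _ _ _ f g h)).trans (map_add φ _ _)⟩⟩

/-- The morphism into `coind j D` determined by a group homomorphism `F j ⟶ D`. -/
def toCoind {F : J ⥤+ AddCommGrpCat.{v}} {j : J} {D : AddCommGrpCat.{v}} (a : F.obj.obj j ⟶ D) :
    F ⟶ coind j D :=
  ObjectProperty.homMk
    { app := fun l => AddCommGrpCat.ofHom
        { toFun := fun x => AddMonoidHom.mk' (fun h => a (F.obj.map h x))
            (fun h k => by simp [Functor.map_add])
          map_zero' := AddMonoidHom.ext fun h => by simp
          map_add' := fun x y => AddMonoidHom.ext fun h => by simp }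
      naturality := fun l l' f => AddCommGrpCat.hom_ext <| AddMonoidHom.ext fun x =>
        AddMonoidHom.ext fun h => by
          change a (F.obj.map h (F.obj.map f x)) = a (F.obj.map (f ≫ h) x)
          simp }

lemma toCoind_apply {F : J ⥤+ AddCommGrpCat.{v}} {j : J} {D : AddCommGrpCat.{v}}
    (a : F.obj.obj j ⟶ D) (l : J) (x : F.obj.obj l) (h : l ⟶ j) :
    DFunLike.coe (F := (l ⟶ j) →+ D) ((toCoind a).hom.app l x) h = a (F.obj.map h x) := rfl

lemma mono_app {F G : J ⥤+ AddCommGrpCat.{v}} (f : F ⟶ G) [Mono f] (l : J) :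
    Mono (f.hom.app l) := by
  have := (additiveFunctor J AddCommGrpCat.{v}).preservesMonomorphisms_ι_of_isNormalEpiCategory
  have : Mono f.hom := inferInstanceAs (Mono ((additiveFunctor J AddCommGrpCat.{v}).ι.map f))
  infer_instance

instance (j : J) (D : AddCommGrpCat.{v}) [Injective D] : Injective (coind j D) where
  factors {X Y} g f _ := by
    have := mono_app f j
    let a : X.obj.obj j ⟶ D := g.hom.app j ≫ AddCommGrpCat.ofHom
      (AddMonoidHom.eval (M := (j ⟶ j)) (N := D) (𝟙 j))
    refine ⟨toCoind (Injective.factorThru a (f.hom.app j)), ?_⟩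
    ext l x
    refine AddMonoidHom.ext (M := (l ⟶ j)) fun h => ?_
    have h1 : f.hom.app j (X.obj.map h x) = Y.obj.map h (f.hom.app l x) :=
      ConcreteCategory.congr_hom (f.hom.naturality h) x
    have h2 : g.hom.app j (X.obj.map h x) = (coind j D).obj.map h (g.hom.app l x) :=
      ConcreteCategory.congr_hom (g.hom.naturality h) x
    have h3 := ConcreteCategory.congr_hom (Injective.comp_factorThru a (f.hom.app j))
      (X.obj.map h x)
    change Injective.factorThru a (f.hom.app j) (Y.obj.map h (f.hom.app l x)) = _
    rw [← h1]
    refine h3.trans ?_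
    change DFunLike.coe (F := (j ⟶ j) →+ D) (g.hom.app j (X.obj.map h x)) (𝟙 j) = _
    rw [h2]
    exact congrArg (DFunLike.coe (F := (l ⟶ j) →+ D) (g.hom.app l x)) (Category.comp_id h)

instance [EssentiallySmall.{v} J] : EnoughInjectives (J ⥤+ AddCommGrpCat.{v}) where
  presentation F := by
    let e := equivSmallModel.{v} J
    let j : SmallModel.{v} J → J := fun s => e.inverse.obj s
    let I : J ⥤+ AddCommGrpCat.{v} := ∏ᶜ fun s => coind (j s) (Injective.under (F.obj.obj (j s)))
    let i : F ⟶ I := Pi.lift fun s => toCoind (Injective.ι (F.obj.obj (j s)))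
    have : Mono i := by
      have : Mono i.hom := by
        rw [NatTrans.mono_iff_mono_app]
        intro l
        rw [AddCommGrpCat.mono_iff_injective, injective_iff_map_eq_zero]
        intro x hx
        let s := e.functor.obj l
        let h : l ⟶ j s := (e.unitIso.app l).hom
        have h1 : (i ≫ Pi.π _ s).hom.app l x = 0 := by
          change (Pi.π _ s : I ⟶ _).hom.app l (i.hom.app l x) = 0
          rw [hx, map_zero]
        rw [Pi.lift_π] at h1
        have h2 : Injective.ι (F.obj.obj (j s)) (F.obj.map h x) = 0 :=
          congrArg (fun φ : (l ⟶ j s) →+ _ => φ h) h1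
        have h3 : F.obj.map h x = 0 :=
          (AddCommGrpCat.mono_iff_injective _).1 (Injective.ι_mono (F.obj.obj (j s)))
            (h2.trans (map_zero _).symm)
        have h4 : Function.Injective (F.obj.map h) :=
          (AddCommGrpCat.mono_iff_injective _).1 inferInstance
        exact h4 (h3.trans (map_zero _).symm)
      exact (additiveFunctor J AddCommGrpCat.{v}).ι.mono_of_mono_map this
    exact ⟨⟨I, inferInstance, i, this⟩⟩

end Injectives

end AGJ
namespace AGJ

set_option linter.unusedSectionVars false

section FinitelyPresented

variable (C : Type u') [Category.{v} C] [Abelian C]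

/-- A functor `F : C ⥤ Ab` is finitely presented if there is a sequence of natural transformations
`(Y, -) ⟶ (X, -) ⟶ F ⟶ 0` which is exact at every object. (Such an `F` is additive.) -/
def isFP : ObjectProperty (C ⥤ AddCommGrpCat.{v}) := fun F =>
  ∃ (X Y : C) (q : preadditiveCoyoneda.obj (op Y) ⟶ preadditiveCoyoneda.obj (op X))
    (p : preadditiveCoyoneda.obj (op X) ⟶ F),
    ∀ A : C, Function.Exact (q.app A) (p.app A) ∧ Function.Surjective (p.app A)

variable {C}

/-- An additive functor is generated by `a : F X` with relations `f : X ⟶ Y`. -/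
structure IsGen (F : C ⥤ AddCommGrpCat.{v}) {X Y : C} (f : X ⟶ Y) (a : F.obj X) : Prop where
  additive : F.Additive
  surj : ∀ (A : C) (b : F.obj A), ∃ x : X ⟶ A, F.map x a = b
  rel : ∀ (A : C) (x : X ⟶ A), F.map x a = 0 ↔ ∃ y : Y ⟶ A, f ≫ y = x

/-- The natural transformation `(X, -) ⟶ F` corresponding to an element of `F X`. -/
def yonedaDesc {F : C ⥤ AddCommGrpCat.{v}} (hF : F.Additive) {X : C} (a : F.obj X) :
    preadditiveCoyoneda.obj (op X) ⟶ F where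
  app A := AddCommGrpCat.ofHom (AddMonoidHom.mk' (fun x : X ⟶ A => F.map x a)
    (fun x y =>
      ConcreteCategory.congr_hom (F.map_add (f := x) (g := y)) a))
  naturality A B g := AddCommGrpCat.hom_ext <| AddMonoidHom.ext fun (x : X ⟶ A) => by
    change F.map (x ≫ g) a = F.map g (F.map x a)
    simp

lemma yonedaDesc_app {F : C ⥤ AddCommGrpCat.{v}} (hF : F.Additive) {X : C} (a : F.obj X) {A : C}
    (x : X ⟶ A) : (yonedaDesc hF a).app A x = F.map x a := rfl

lemma nat_apply {F G : C ⥤ AddCommGrpCat.{v}} (p : F ⟶ G) {A B : C} (f : A ⟶ B) (x : F.obj A) :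
    p.app B (F.map f x) = G.map f (p.app A x) :=
  ConcreteCategory.congr_hom (p.naturality f) x

lemma yoneda_apply {F : C ⥤ AddCommGrpCat.{v}} {X : C}
    (p : preadditiveCoyoneda.obj (op X) ⟶ F) {A : C} (x : X ⟶ A) :
    p.app A x = F.map x (p.app X (𝟙 X)) := by
  refine Eq.trans ?_ (nat_apply p x _)
  exact congrArg (p.app A) (Category.id_comp x).symm

lemma exact_app_of_kernel {F G : C ⥤ AddCommGrpCat.{v}} {φ : F ⟶ G} (k : KernelFork φ)
    (hk : IsLimit k) (A : C) : Function.Injective (k.ι.app A) ∧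
      Function.Exact (k.ι.app A) (φ.app A) := by
  have : Mono k.ι := mono_of_isLimit_fork hk
  have h1 : (ShortComplex.mk k.ι φ k.condition).Exact := ShortComplex.exact_of_f_is_kernel _
    (IsLimit.ofIsoLimit hk (Fork.ext (Iso.refl _)))
  have h2 := h1.map ((evaluation C AddCommGrpCat.{v}).obj A)
  refine ⟨(AddCommGrpCat.mono_iff_injective _).1 inferInstance, fun x => ?_⟩
  refine ⟨fun hx => (ShortComplex.ab_exact_iff _).1 h2 x hx, ?_⟩
  rintro ⟨y, rfl⟩
  exact ConcreteCategory.congr_hom (congrArg (fun α => α.app A) k.condition) y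

lemma exact_app_of_cokernel {F G : C ⥤ AddCommGrpCat.{v}} {φ : F ⟶ G} (k : CokernelCofork φ)
    (hk : IsColimit k) (A : C) : Function.Surjective (k.π.app A) ∧
      Function.Exact (φ.app A) (k.π.app A) := by
  have : Epi k.π := epi_of_isColimit_cofork hk
  have h1 : (ShortComplex.mk φ k.π k.condition).Exact := ShortComplex.exact_of_g_is_cokernel _
    (IsColimit.ofIsoColimit hk (Cofork.ext (Iso.refl _)))
  have h2 := h1.map ((evaluation C AddCommGrpCat.{v}).obj A)
  refine ⟨(AddCommGrpCat.epi_iff_surjective _).1 inferInstance, fun x => ?_⟩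
  refine ⟨fun hx => (ShortComplex.ab_exact_iff _).1 h2 x hx, ?_⟩
  rintro ⟨y, rfl⟩
  exact ConcreteCategory.congr_hom (congrArg (fun α => α.app A) k.condition) y

lemma IsGen.isFP {F : C ⥤ AddCommGrpCat.{v}} {X Y : C} {f : X ⟶ Y} {a : F.obj X}
    (h : IsGen F f a) : isFP C F := by
  refine ⟨X, Y, preadditiveCoyoneda.map f.op, yonedaDesc h.additive a, fun A =>
    ⟨fun x => ?_, h.surj A⟩⟩
  exact h.rel A x

lemma isFP_iff (F : C ⥤ AddCommGrpCat.{v}) :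
    isFP C F ↔ ∃ (X Y : C) (f : X ⟶ Y) (a : F.obj X), IsGen F f a := by
  refine ⟨?_, fun ⟨_, _, _, _, h⟩ => h.isFP⟩
  rintro ⟨X, Y, q, p, h⟩
  have hF : (additiveFunctor C AddCommGrpCat.{v}) F := by
    have : Epi p := by
      have := fun A => (AddCommGrpCat.epi_iff_surjective (p.app A)).2 (h A).2
      exact NatTrans.epi_of_epi_app p
    exact ObjectProperty.prop_of_epi _ p (inferInstanceAs (preadditiveCoyoneda.obj (op X)).Additive)
  refine ⟨X, Y, (q.app Y (𝟙 Y) : X ⟶ Y), p.app X (𝟙 X), hF, fun A b => ?_, fun A x => ?_⟩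
  · obtain ⟨x, rfl⟩ := (h A).2 b
    exact ⟨x, (yoneda_apply p x).symm⟩
  · rw [← yoneda_apply p x]
    refine ((h A).1 x).trans ⟨fun ⟨y, hy⟩ => ⟨y, ?_⟩, fun ⟨y, hy⟩ => ⟨y, ?_⟩⟩
    · rw [← hy, yoneda_apply q y]; rfl
    · rw [← hy, yoneda_apply q y]; rfl

lemma isFP_additive {F : C ⥤ AddCommGrpCat.{v}} (h : isFP C F) : F.Additive := by
  obtain ⟨_, _, _, _, h⟩ := (isFP_iff F).1 h
  exact h.additive

lemma isFP_coyoneda (X : Cᵒᵖ) : isFP C (preadditiveCoyoneda.obj X) :=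
  IsGen.isFP (X := X.unop) (Y := 0) (f := 0) (a := 𝟙 X.unop)
    ⟨inferInstance, fun A b => ⟨b, Category.id_comp b⟩, fun A x => by
      change 𝟙 _ ≫ x = 0 ↔ _
      simp [eq_comm]⟩

instance : (isFP C).IsClosedUnderIsomorphisms where
  of_iso {F G} e hF := by
    obtain ⟨X, Y, q, p, h⟩ := hF
    refine ⟨X, Y, q, p ≫ e.hom, fun A => ?_⟩
    have hb : Function.Bijective (e.hom.app A) :=
      (ConcreteCategory.isIso_iff_bijective (e.hom.app A)).1 inferInstance
    refine ⟨fun x => ?_, hb.2.comp (h A).2⟩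
    rw [← (h A).1 x]
    change e.hom.app A (p.app A x) = 0 ↔ _
    exact ⟨fun hx => hb.1 (hx.trans (map_zero _).symm), fun hx => by rw [hx, map_zero]⟩

instance : (isFP C).ContainsZero where
  exists_zero := by
    refine ⟨(Functor.const C).obj 0, Functor.isZero _ fun _ => isZero_zero _, ?_⟩
    have : ∀ x y : ((0 : AddCommGrpCat.{v}) : Type v), x = y := fun x y =>
      (AddCommGrpCat.subsingleton_of_isZero (isZero_zero _)).elim x y
    exact IsGen.isFP (X := 0) (Y := 0) (f := 0) (a := (0 : ((0 : AddCommGrpCat.{v}) : Type v)))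
      ⟨⟨fun {_ _ _ _} => (isZero_zero AddCommGrpCat.{v}).eq_of_src _ _⟩,
        fun A b => ⟨0, this _ _⟩, fun A x => ⟨fun _ => ⟨0, by
          rw [zero_comp]; exact ((isZero_zero C).eq_of_src _ _)⟩, fun _ => this _ _⟩⟩

instance : (isFP C).IsClosedUnderKernels where
  kernels_le := by
    rintro _ ⟨φ, k, hk, hφ⟩
    rename_i F G
    obtain ⟨hF, hG⟩ := hφ
    obtain ⟨X, Y, f, a, hF⟩ := (isFP_iff F).1 hF
    obtain ⟨X', Y', f', a', hG⟩ := (isFP_iff G).1 hG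
    have hK : (additiveFunctor C AddCommGrpCat.{v}) k.pt := by
      have : Mono k.ι := mono_of_isLimit_fork hk
      exact ObjectProperty.prop_of_mono _ k.ι hF.additive
    have hk' := exact_app_of_kernel k hk
    obtain ⟨u, hu⟩ := hG.surj X (φ.app X a)
    have hφ : ∀ {A : C} (x : X ⟶ A), φ.app A (F.map x a) = G.map (u ≫ x) a' := fun x => by
      rw [nat_apply, ← hu]; simp
    have h0 : φ.app _ (F.map (pushout.inl u f') a) = 0 := by
      rw [hφ, hG.rel]
      exact ⟨pushout.inr u f', pushout.condition.symm⟩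
    obtain ⟨c, hc⟩ := ((hk' _).2 _).1 h0
    have hkc : ∀ {A : C} (t : pushout u f' ⟶ A),
        k.ι.app A (k.pt.map t c) = F.map (pushout.inl u f' ≫ t) a := fun t => by
      rw [nat_apply, hc]; simp
    refine IsGen.isFP (f := pushout.inl (pushout.inl u f') f) (a := c)
      ⟨hK, fun A b => ?_, fun A t => ?_⟩
    · obtain ⟨x, hx⟩ := hF.surj A (k.ι.app A b)
      have h1 : φ.app A (F.map x a) = 0 := by
        rw [hx]; exact ((hk' A).2 _).2 ⟨b, rfl⟩
      rw [hφ, hG.rel] at h1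
      obtain ⟨y, hy⟩ := h1
      refine ⟨pushout.desc x y hy.symm, (hk' A).1 ?_⟩
      rw [hkc, pushout.inl_desc, hx]
    · have h1 : k.pt.map t c = 0 ↔ F.map (pushout.inl u f' ≫ t) a = 0 := by
        rw [← hkc]
        exact ⟨fun h => by rw [h, map_zero], fun h => (hk' A).1 (h.trans (map_zero _).symm)⟩
      rw [h1, hF.rel]
      constructor
      · rintro ⟨y, hy⟩
        exact ⟨pushout.desc t y hy.symm, pushout.inl_desc _ _ _⟩
      · rintro ⟨w, rfl⟩
        exact ⟨pushout.inr _ _ ≫ w, by rw [← Category.assoc, ← pushout.condition, Category.assoc]⟩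

instance : (isFP C).IsClosedUnderCokernels where
  cokernels_le := by
    rintro _ ⟨φ, k, hk, hφ⟩
    rename_i F G
    obtain ⟨hF, hG⟩ := hφ
    obtain ⟨X, Y, f, a, hF⟩ := (isFP_iff F).1 hF
    obtain ⟨X', Y', f', a', hG⟩ := (isFP_iff G).1 hG
    have hK : (additiveFunctor C AddCommGrpCat.{v}) k.pt := by
      have : Epi k.π := epi_of_isColimit_cofork hk
      exact ObjectProperty.prop_of_epi _ k.π hG.additive
    have hk' := exact_app_of_cokernel k hk
    have hGa := hG.additive
    obtain ⟨u, hu⟩ := hG.surj X (φ.app X a)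
    have hφ : ∀ {A : C} (x : X ⟶ A), φ.app A (F.map x a) = G.map (u ≫ x) a' := fun x => by
      rw [nat_apply, ← hu]; simp
    refine IsGen.isFP (f := biprod.lift u f') (a := k.π.app _ a') ⟨hK, fun A b => ?_, fun A t => ?_⟩
    · obtain ⟨b, rfl⟩ := (hk' A).1 b
      obtain ⟨x, rfl⟩ := hG.surj A b
      exact ⟨x, (nat_apply k.π x a').symm⟩
    · rw [← nat_apply, (hk' A).2]
      constructor
      · rintro ⟨b, hb⟩
        obtain ⟨x, rfl⟩ := hF.surj A b
        rw [hφ] at hb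
        have h1 : G.map (t - u ≫ x) a' = 0 := by
          rw [Functor.map_sub]
          change G.map t a' - G.map (u ≫ x) a' = 0
          rw [hb, sub_self]
        obtain ⟨y, hy⟩ := (hG.rel _ _).1 h1
        exact ⟨biprod.desc x y, by rw [biprod.lift_desc, hy]; abel⟩
      · rintro ⟨w, rfl⟩
        refine ⟨F.map (biprod.inl ≫ w) a, ?_⟩
        rw [hφ]
        have h1 : biprod.lift u f' ≫ w = u ≫ biprod.inl ≫ w + f' ≫ biprod.inr ≫ w := by
          rw [biprod.lift_eq]; simp
        have h2 : G.map (f' ≫ biprod.inr ≫ w) a' = 0 := (hG.rel _ _).2 ⟨_, rfl⟩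
        rw [h1, Functor.map_add]
        change _ = G.map (u ≫ biprod.inl ≫ w) a' + G.map (f' ≫ biprod.inr ≫ w) a'
        rw [h2, add_zero]

lemma isFP_biprod {F G : C ⥤ AddCommGrpCat.{v}} (hF : isFP C F) (hG : isFP C G) :
    isFP C (F ⊞ G) := by
  obtain ⟨X, Y, f, a, hF⟩ := (isFP_iff F).1 hF
  obtain ⟨X', Y', f', a', hG⟩ := (isFP_iff G).1 hG
  have hFa := hF.additive
  have hGa := hG.additive
  have e1 : ∀ {A : C} (x : F.obj A), (biprod.fst : F ⊞ G ⟶ F).app A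
      ((biprod.inl : F ⟶ F ⊞ G).app A x) = x := fun {A} x =>
    ConcreteCategory.congr_hom (NatTrans.congr_app (biprod.inl_fst (X := F) (Y := G)) A) x
  have e2 : ∀ {A : C} (x : F.obj A), (biprod.snd : F ⊞ G ⟶ G).app A
      ((biprod.inl : F ⟶ F ⊞ G).app A x) = 0 := fun {A} x =>
    ConcreteCategory.congr_hom (NatTrans.congr_app (biprod.inl_snd (X := F) (Y := G)) A) x
  have e3 : ∀ {A : C} (x : G.obj A), (biprod.fst : F ⊞ G ⟶ F).app A
      ((biprod.inr : G ⟶ F ⊞ G).app A x) = 0 := fun {A} x =>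
    ConcreteCategory.congr_hom (NatTrans.congr_app (biprod.inr_fst (X := F) (Y := G)) A) x
  have e4 : ∀ {A : C} (x : G.obj A), (biprod.snd : F ⊞ G ⟶ G).app A
      ((biprod.inr : G ⟶ F ⊞ G).app A x) = x := fun {A} x =>
    ConcreteCategory.congr_hom (NatTrans.congr_app (biprod.inr_snd (X := F) (Y := G)) A) x
  have e5 : ∀ {A : C} (b : (F ⊞ G).obj A), (biprod.inl : F ⟶ F ⊞ G).app A
      ((biprod.fst : F ⊞ G ⟶ F).app A b) + (biprod.inr : G ⟶ F ⊞ G).app A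
      ((biprod.snd : F ⊞ G ⟶ G).app A b) = b := fun {A} b =>
    ConcreteCategory.congr_hom (NatTrans.congr_app (biprod.total (X := F) (Y := G)) A) b
  have e6 : ∀ {A : C} (b : (F ⊞ G).obj A), (biprod.fst : F ⊞ G ⟶ F).app A b = 0 →
      (biprod.snd : F ⊞ G ⟶ G).app A b = 0 → b = 0 := fun b h1 h2 => by
    rw [← e5 b, h1, h2, map_zero, map_zero, add_zero]
  let c : (F ⊞ G).obj (X ⊞ X') := (biprod.inl : F ⟶ F ⊞ G).app _ (F.map biprod.inl a) +
    (biprod.inr : G ⟶ F ⊞ G).app _ (G.map biprod.inr a')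
  have c1 : ∀ {A : C} (t : X ⊞ X' ⟶ A), (biprod.fst : F ⊞ G ⟶ F).app A ((F ⊞ G).map t c) =
      F.map (biprod.inl ≫ t) a := fun t => by
    rw [nat_apply, map_add, e1, e3, add_zero]; simp
  have c2 : ∀ {A : C} (t : X ⊞ X' ⟶ A), (biprod.snd : F ⊞ G ⟶ G).app A ((F ⊞ G).map t c) =
      G.map (biprod.inr ≫ t) a' := fun t => by
    rw [nat_apply, map_add, e2, e4, zero_add]; simp
  have hadd : (F ⊞ G).Additive := ⟨fun {A B g h} => by
    ext b
    refine sub_eq_zero.1 (e6 _ ?_ ?_)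
    · rw [map_sub, nat_apply, sub_eq_zero, Functor.map_add]
      change F.map g _ + F.map h _ = (biprod.fst : F ⊞ G ⟶ F).app B ((F ⊞ G).map g b + (F ⊞ G).map h b)
      rw [map_add, nat_apply, nat_apply]
    · rw [map_sub, nat_apply, sub_eq_zero, Functor.map_add]
      change G.map g _ + G.map h _ = (biprod.snd : F ⊞ G ⟶ G).app B ((F ⊞ G).map g b + (F ⊞ G).map h b)
      rw [map_add, nat_apply, nat_apply]⟩
  refine IsGen.isFP (f := biprod.map f f') (a := c) ⟨hadd, fun A b => ?_, fun A t => ?_⟩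
  · obtain ⟨x, hx⟩ := hF.surj A ((biprod.fst : F ⊞ G ⟶ F).app A b)
    obtain ⟨x', hx'⟩ := hG.surj A ((biprod.snd : F ⊞ G ⟶ G).app A b)
    refine ⟨biprod.desc x x', sub_eq_zero.1 (e6 _ ?_ ?_)⟩
    · rw [map_sub, c1, biprod.inl_desc, hx, sub_self]
    · rw [map_sub, c2, biprod.inr_desc, hx', sub_self]
  · constructor
    · intro h
      have h1 := c1 t
      have h2 := c2 t
      rw [h, map_zero] at h1 h2
      obtain ⟨y, hy⟩ := (hF.rel _ _).1 h1.symm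
      obtain ⟨y', hy'⟩ := (hG.rel _ _).1 h2.symm
      refine ⟨biprod.desc y y', ?_⟩
      ext <;> simp [hy, hy']
    · rintro ⟨y, rfl⟩
      refine e6 _ ?_ ?_
      · rw [c1, hF.rel]
        exact ⟨biprod.inl ≫ y, by simp⟩
      · rw [c2, hG.rel]
        exact ⟨biprod.inr ≫ y, by simp⟩

instance : (isFP C).IsClosedUnderBinaryProducts where
  limitsOfShape_le := by
    rintro P ⟨p⟩
    let F := p.diag.obj ⟨WalkingPair.left⟩
    let G := p.diag.obj ⟨WalkingPair.right⟩
    let e : P ≅ F ⊞ G := p.isLimit.conePointUniqueUpToIso (limit.isLimit _) ≪≫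
      HasLimit.isoOfNatIso (diagramIsoPair p.diag) ≪≫ (biprod.isoProd F G).symm
    exact ObjectProperty.prop_of_iso _ e.symm
      (isFP_biprod (p.prop_diag_obj _) (p.prop_diag_obj _))

instance : (isFP C).IsClosedUnderFiniteProducts := .mk'

variable (C) in
/-- The category `fp(C, Ab)` of finitely presented functors, with all natural transformations. -/
abbrev FP := (isFP C).FullSubcategory

noncomputable instance : Abelian (FP C) := inferInstance

variable (C) in
/-- The Yoneda embedding `X ↦ (X, -)`, contravariant in `X`. -/
def yonedaFP : Cᵒᵖ ⥤ FP C := (isFP C).lift preadditiveCoyoneda isFP_coyoneda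

instance : (yonedaFP C).Full := inferInstanceAs ((isFP C).lift _ _).Full

instance : (yonedaFP C).Faithful := inferInstanceAs ((isFP C).lift _ _).Faithful

instance : (yonedaFP C).Additive where
  map_add {X Y f g} := by
    ext A x
    exact Preadditive.add_comp _ _ _ f.unop g.unop x

lemma surjective_app_of_epi {F G : FP C} (φ : F ⟶ G) [Epi φ] (A : C) :
    Function.Surjective (φ.hom.app A) := by
  have := (isFP C).preservesEpimorphisms_ι_of_isNormalMonoCategory
  have : Epi φ.hom := inferInstanceAs (Epi ((isFP C).ι.map φ))
  exact (AddCommGrpCat.epi_iff_surjective _).1 inferInstance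

instance (X : Cᵒᵖ) : Projective ((yonedaFP C).obj X) where
  factors {E F} f e _ := by
    obtain ⟨b, hb⟩ := surjective_app_of_epi e X.unop (f.hom.app X.unop (𝟙 X.unop))
    refine ⟨ObjectProperty.homMk (yonedaDesc (isFP_additive E.property) b), ?_⟩
    ext A x
    refine (nat_apply e.hom (x : X.unop ⟶ A) b).trans ?_
    rw [hb]
    exact (yoneda_apply (X := X.unop) f.hom (A := A) x).symm

lemma exists_epi_yonedaFP (F : FP C) : ∃ (X : C) (p : (yonedaFP C).obj (op X) ⟶ F), Epi p := by
  obtain ⟨X, Y, q, p, h⟩ := F.property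
  refine ⟨X, ObjectProperty.homMk p, (isFP C).ι.epi_of_epi_map ?_⟩
  have := fun A => (AddCommGrpCat.epi_iff_surjective (p.app A)).2 (h A).2
  exact NatTrans.epi_of_epi_app p

instance : EnoughProjectives (FP C) where
  presentation F := by
    obtain ⟨X, p, _⟩ := exists_epi_yonedaFP F
    exact ⟨{ p := (yonedaFP C).obj (op X), f := p }⟩

instance : (yonedaFP C).IsRightAdjoint := by
  apply Functor.isRightAdjoint_of_leftAdjointObjIsDefined_eq_top
  have hY : ∀ X, (yonedaFP C).leftAdjointObjIsDefined ((yonedaFP C).obj X) := fun X =>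
    ⟨X, ⟨⟨fun {Z} => (Functor.FullyFaithful.ofFullyFaithful (yonedaFP C)).homEquiv,
      fun f g => (yonedaFP C).map_comp _ _⟩⟩⟩
  ext F
  obtain ⟨X, p, _⟩ := exists_epi_yonedaFP F
  obtain ⟨Y, q, _⟩ := exists_epi_yonedaFP (kernel p)
  have h1 := Functor.leftAdjointObjIsDefined_of_isColimit (F := yonedaFP C) (isCokernelEpiComp
    (Abelian.epiIsCokernelOfKernel _ (kernelIsKernel p)) q rfl)
    (by rintro (_ | _); exacts [hY _, hY _])
  exact ⟨fun _ => trivial, fun _ => h1⟩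

variable (C) in
/-- The contravariant functor `w : fp(C, Ab) ⟶ C`, the adjoint of the Yoneda embedding:
`Hom(w F, X)` in `Cᵒᵖ` is naturally `Nat(F, (X, -))`. -/
noncomputable def w : FP C ⥤ Cᵒᵖ := (yonedaFP C).leftAdjoint

variable (C) in
/-- The adjunction between `w` and the Yoneda embedding. -/
noncomputable def wAdjunction : w C ⊣ yonedaFP C := Adjunction.ofIsRightAdjoint _

instance : (w C).Additive := (wAdjunction C).left_adjoint_additive

end FinitelyPresented
end AGJ
namespace AGJ

section LeftDerivedZero

variable {C : Type*} [Category* C] [Abelian C] [EnoughProjectives C]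
  {D : Type*} [Category* D] [Abelian D] (F : C ⥤ D) [F.Additive]

/-- The augmentation `P₀ ⟶ X` of a projective resolution. -/
def aug {X : C} (P : ProjectiveResolution X) : P.complex.X 0 ⟶ X := P.π.f 0

instance {X : C} (P : ProjectiveResolution X) : Epi (aug P) := inferInstanceAs (Epi (P.π.f 0))

/-- Auxiliary form of `toLeftDerivedZero`. -/
noncomputable def toLeftDerivedZeroAux {X : C} (P : ProjectiveResolution X) :
    ((F.mapHomologicalComplex (ComplexShape.down ℕ)).obj P.complex).X 0 ⟶
      (F.leftDerived 0).obj X :=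
  ((F.mapHomologicalComplex (ComplexShape.down ℕ)).obj P.complex).pOpcycles 0 ≫
    (ChainComplex.isoHomologyι₀ _).inv ≫ (show (F.leftDerived 0).obj X ≅
      ((F.mapHomologicalComplex (ComplexShape.down ℕ)).obj P.complex).homology 0 from
      P.isoLeftDerivedObj F 0).inv

/-- The canonical map from `F P₀` to the zeroth left derived functor. -/
noncomputable def toLeftDerivedZero {X : C} (P : ProjectiveResolution X) :
    F.obj (P.complex.X 0) ⟶ (F.leftDerived 0).obj X := toLeftDerivedZeroAux F P

lemma toLeftDerivedZero_naturality {X Y : C} (f : X ⟶ Y) (P : ProjectiveResolution X)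
    (Q : ProjectiveResolution Y) (φ : P.complex ⟶ Q.complex)
    (comm : φ.f 0 ≫ Q.π.f 0 = P.π.f 0 ≫ f) :
    toLeftDerivedZero F P ≫ (F.leftDerived 0).map f =
      F.map (φ.f 0) ≫ toLeftDerivedZero F Q := by
  have h : (show (F.leftDerived 0).obj X ≅
      ((F.mapHomologicalComplex (ComplexShape.down ℕ)).obj P.complex).homology 0 from
      P.isoLeftDerivedObj F 0).inv ≫ (F.leftDerived 0).map f =
      HomologicalComplex.homologyMap ((F.mapHomologicalComplex _).map φ) 0 ≫
      (show (F.leftDerived 0).obj Y ≅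
      ((F.mapHomologicalComplex (ComplexShape.down ℕ)).obj Q.complex).homology 0 from
      Q.isoLeftDerivedObj F 0).inv :=
    ProjectiveResolution.isoLeftDerivedObj_inv_naturality f P Q φ comm F 0
  have h' := ChainComplex.isoHomologyι₀_inv_naturality ((F.mapHomologicalComplex _).map φ)
  have h'' := HomologicalComplex.p_opcyclesMap ((F.mapHomologicalComplex _).map φ) 0
  have : toLeftDerivedZeroAux F P ≫ (F.leftDerived 0).map f =
      ((F.mapHomologicalComplex _).map φ).f 0 ≫ toLeftDerivedZeroAux F Q := by
    unfold toLeftDerivedZeroAux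
    rw [Category.assoc, Category.assoc, h, reassoc_of% h', reassoc_of% h'']
  exact this

lemma toLeftDerivedZero_comp {X : C} (P : ProjectiveResolution X) :
    toLeftDerivedZero F P ≫ F.fromLeftDerivedZero.app X = F.map (P.π.f 0) := by
  have : toLeftDerivedZeroAux F P ≫ (show (F.leftDerived 0).obj X ≅
      ((F.mapHomologicalComplex (ComplexShape.down ℕ)).obj P.complex).homology 0 from
      P.isoLeftDerivedObj F 0).hom ≫ (ChainComplex.isoHomologyι₀ _).hom ≫
        P.fromLeftDerivedZero' F =
      ((F.mapHomologicalComplex (ComplexShape.down ℕ)).obj P.complex).pOpcycles 0 ≫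
        P.fromLeftDerivedZero' F := by
    unfold toLeftDerivedZeroAux
    rw [Category.assoc, Category.assoc, Iso.inv_hom_id_assoc, Iso.inv_hom_id_assoc]
  rw [P.fromLeftDerivedZero_eq F]
  exact this.trans (P.pOpcycles_comp_fromLeftDerivedZero' F)

lemma map_d_toLeftDerivedZero {X : C} (P : ProjectiveResolution X) :
    F.map (P.complex.d 1 0) ≫ toLeftDerivedZero F P = 0 := by
  have : ((F.mapHomologicalComplex (ComplexShape.down ℕ)).obj P.complex).d 1 0 ≫
      toLeftDerivedZeroAux F P = 0 := by
    unfold toLeftDerivedZeroAux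
    rw [HomologicalComplex.d_pOpcycles_assoc, zero_comp]
  exact this

lemma fromLeftDerivedZero_comp {X : C} (P : ProjectiveResolution X) :
    F.fromLeftDerivedZero.app (P.complex.X 0) ≫ toLeftDerivedZero F P =
      (F.leftDerived 0).map (aug P) := by
  have hp := P.projective 0
  let Q := ProjectiveResolution.self (P.complex.X 0)
  let φ := ProjectiveResolution.lift (P.π.f 0) Q P
  obtain ⟨t, ht1, ht2⟩ : ∃ t : F.obj (P.complex.X 0) ⟶ (F.leftDerived 0).obj (P.complex.X 0),
      t ≫ F.fromLeftDerivedZero.app (P.complex.X 0) = 𝟙 _ ∧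
      t ≫ (F.leftDerived 0).map (aug P) = F.map (φ.f 0) ≫ toLeftDerivedZero F P :=
    ⟨toLeftDerivedZero F Q, (toLeftDerivedZero_comp F Q).trans (F.map_id _),
      toLeftDerivedZero_naturality F (P.π.f 0) Q P φ
        (ProjectiveResolution.lift_commutes_zero (P.π.f 0) Q P)⟩
  obtain ⟨φ₀, hφ₀, ht3⟩ : ∃ φ₀ : P.complex.X 0 ⟶ P.complex.X 0, φ₀ ≫ aug P = aug P ∧
      t ≫ (F.leftDerived 0).map (aug P) = F.map φ₀ ≫ toLeftDerivedZero F P :=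
    ⟨φ.f 0, (ProjectiveResolution.lift_commutes_zero (P.π.f 0) Q P).trans (Category.id_comp _), ht2⟩
  have h0 : (φ₀ - 𝟙 _) ≫ aug P = 0 := by
    rw [Preadditive.sub_comp, hφ₀, Category.id_comp, sub_self]
  have h4 : F.map φ₀ ≫ toLeftDerivedZero F P = toLeftDerivedZero F P := by
    have h5 := P.exact₀.liftFromProjective_comp (φ₀ - 𝟙 _) h0
    have h6 : φ₀ = P.exact₀.liftFromProjective (φ₀ - 𝟙 _) h0 ≫ P.complex.d 1 0 + 𝟙 _ :=
      sub_eq_iff_eq_add.1 h5.symm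
    rw [h6, F.map_add, F.map_comp, Preadditive.add_comp, Category.assoc,
      map_d_toLeftDerivedZero, comp_zero, zero_add, F.map_id, Category.id_comp]
  rw [h4] at ht3
  have h7 : F.fromLeftDerivedZero.app (P.complex.X 0) ≫ t = 𝟙 _ := by
    rw [← cancel_mono (F.fromLeftDerivedZero.app (P.complex.X 0)), Category.assoc, ht1,
      Category.comp_id, Category.id_comp]
  rw [← ht3, reassoc_of% h7]

instance epi_toLeftDerivedZero {X : C} (P : ProjectiveResolution X) :
    Epi (toLeftDerivedZero F P) := by
  have : Epi (toLeftDerivedZeroAux F P) := by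
    unfold toLeftDerivedZeroAux
    infer_instance
  exact this

lemma exists_toLeftDerivedZero_desc {X : C} (P : ProjectiveResolution X) {Z : D}
    (h : F.obj (P.complex.X 0) ⟶ Z) (hh : F.map (P.complex.d 1 0) ≫ h = 0) :
    ∃ k, toLeftDerivedZero F P ≫ k = h := by
  refine ⟨(show (F.leftDerived 0).obj X ≅
      ((F.mapHomologicalComplex (ComplexShape.down ℕ)).obj P.complex).homology 0 from
      P.isoLeftDerivedObj F 0).hom ≫ (ChainComplex.isoHomologyι₀ _).hom ≫
    HomologicalComplex.descOpcycles _ h 1 (by simp) hh, ?_⟩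
  have : toLeftDerivedZeroAux F P ≫ (show (F.leftDerived 0).obj X ≅
      ((F.mapHomologicalComplex (ComplexShape.down ℕ)).obj P.complex).homology 0 from
      P.isoLeftDerivedObj F 0).hom ≫ (ChainComplex.isoHomologyι₀ _).hom ≫
      HomologicalComplex.descOpcycles _ h 1 (by simp) hh = h := by
    unfold toLeftDerivedZeroAux
    rw [Category.assoc, Category.assoc, Iso.inv_hom_id_assoc, Iso.inv_hom_id_assoc]
    exact HomologicalComplex.p_descOpcycles _ _ _ _ _
  exact this

instance epi_map_aug {X : C} (P : ProjectiveResolution X) :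
    Epi ((F.leftDerived 0).map (aug P)) := by
  have : Projective (P.complex.X 0) := P.projective 0
  have := epi_toLeftDerivedZero F P
  rw [← fromLeftDerivedZero_comp]
  exact epi_comp _ _

lemma leftDerivedZero_map_epi {B X : C} (e : B ⟶ X) [Epi e] : Epi ((F.leftDerived 0).map e) := by
  let P := projectiveResolution X
  have : Projective (P.complex.X 0) := P.projective 0
  have h := Projective.factorThru_comp (aug P) e
  have h1 : Epi ((F.leftDerived 0).map (Projective.factorThru (aug P) e) ≫
      (F.leftDerived 0).map e) := by
    rw [← Functor.map_comp, h]
    infer_instance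
  exact epi_of_epi ((F.leftDerived 0).map (Projective.factorThru (aug P) e)) _

instance : (F.leftDerived 0).Additive where
  map_add {X Y a b} := by
    let P := projectiveResolution X
    let Q := projectiveResolution Y
    have hP : Projective (P.complex.X 0) := P.projective 0
    have hQ : Projective (Q.complex.X 0) := Q.projective 0
    obtain ⟨p, hp, hp'⟩ : ∃ p : P.complex.X 0 ⟶ X, p = aug P ∧ Epi ((F.leftDerived 0).map p) :=
      ⟨aug P, rfl, inferInstance⟩
    obtain ⟨q, hq⟩ : ∃ q : Q.complex.X 0 ⟶ Y, Epi q := ⟨aug Q, inferInstance⟩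
    have key : ∀ u v : P.complex.X 0 ⟶ Q.complex.X 0, (F.leftDerived 0).map (u + v) =
        (F.leftDerived 0).map u + (F.leftDerived 0).map v := fun u v => by
      rw [← cancel_mono (F.fromLeftDerivedZero.app (Q.complex.X 0))]
      simp [F.map_add]
    have e1 : p ≫ a = Projective.factorThru (p ≫ a) q ≫ q := by simp
    have e2 : p ≫ b = Projective.factorThru (p ≫ b) q ≫ q := by simp
    rw [← cancel_epi ((F.leftDerived 0).map p), Preadditive.comp_add, ← Functor.map_comp,
      ← Functor.map_comp, ← Functor.map_comp, Preadditive.comp_add, e1, e2, ← Preadditive.add_comp,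
      Functor.map_comp, key, Preadditive.add_comp, ← Functor.map_comp, ← Functor.map_comp]

/-- The zeroth left derived functor is right exact. -/
lemma exists_leftDerivedZero_desc {A B X : C} (f : A ⟶ B) (e : B ⟶ X) [Epi e] (w : f ≫ e = 0)
    (hex : (ShortComplex.mk f e w).Exact) {Z : D} (h : (F.leftDerived 0).obj B ⟶ Z)
    (hh : (F.leftDerived 0).map f ≫ h = 0) : ∃ k, (F.leftDerived 0).map e ≫ k = h := by
  let P := projectiveResolution X
  have hP0 : Projective (P.complex.X 0) := P.projective 0
  have hP1 : Projective (P.complex.X 1) := P.projective 1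
  obtain ⟨p, hp⟩ : ∃ p : P.complex.X 0 ⟶ X, p = aug P := ⟨aug P, rfl⟩
  have hpe : Epi p := hp ▸ inferInstance
  have hd : P.complex.d 1 0 ≫ p = 0 := hp ▸ P.complex_d_comp_π_f_zero
  have fac : ∀ {T : C} [Projective T] (g : T ⟶ B), g ≫ e = 0 →
      (F.leftDerived 0).map g ≫ h = 0 := fun {T} _ g hg => by
    have h1 := hex.liftFromProjective_comp g hg
    rw [← h1, Functor.map_comp, Category.assoc]
    exact (congrArg (_ ≫ ·) hh).trans comp_zero
  let s := Projective.factorThru p e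
  have hs : s ≫ e = p := Projective.factorThru_comp p e
  have h0 : (F.leftDerived 0).map (P.complex.d 1 0) ≫ (F.leftDerived 0).map s ≫ h = 0 := by
    rw [← Functor.map_comp_assoc]
    exact fac _ (by rw [Category.assoc, hs, hd])
  let i := inv (F.fromLeftDerivedZero.app (P.complex.X 0))
  have hi : F.map (P.complex.d 1 0) ≫ i =
      inv (F.fromLeftDerivedZero.app (P.complex.X 1)) ≫ (F.leftDerived 0).map (P.complex.d 1 0) := by
    rw [IsIso.eq_inv_comp, ← F.fromLeftDerivedZero.naturality_assoc, IsIso.hom_inv_id,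
      Category.comp_id]
  obtain ⟨k, hk⟩ := exists_toLeftDerivedZero_desc F P (i ≫ (F.leftDerived 0).map s ≫ h) (by
    rw [reassoc_of% hi, h0, comp_zero])
  have hk' : (F.leftDerived 0).map p ≫ k = (F.leftDerived 0).map s ≫ h := by
    have := fromLeftDerivedZero_comp F P
    rw [hp]
    refine (congrArg (· ≫ k) this.symm).trans ?_
    rw [Category.assoc, hk, IsIso.hom_inv_id_assoc]
  refine ⟨k, ?_⟩
  let Q := projectiveResolution B
  have hQ0 : Projective (Q.complex.X 0) := Q.projective 0
  obtain ⟨q, hq⟩ : ∃ q : Q.complex.X 0 ⟶ B, Epi ((F.leftDerived 0).map q) :=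
    ⟨aug Q, inferInstance⟩
  let m := Projective.factorThru (q ≫ e) p
  have hm : m ≫ p = q ≫ e := Projective.factorThru_comp _ _
  rw [← cancel_epi ((F.leftDerived 0).map q), ← Functor.map_comp_assoc, ← hm,
    Functor.map_comp_assoc, hk', ← Functor.map_comp_assoc, ← sub_eq_zero, ← Preadditive.sub_comp,
    ← Functor.map_sub]
  exact fac _ (by rw [Preadditive.sub_comp, Category.assoc, hs, hm, sub_self])

end LeftDerivedZero
end AGJ
namespace AGJ

section Tensor

variable (R : Type u) [Ring R]

/-- The category `Mod(R)` of right `R`-modules. -/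
abbrev RMod := ModuleCat.{u} Rᵐᵒᵖ

/-- The category `mod(Rᵒᵖ)` of finitely presented left `R`-modules. -/
abbrev LFPMod :=
  ObjectProperty.FullSubcategory fun M : ModuleCat.{u} R => Module.FinitePresentation R M

/-- The category `(mod(Rᵒᵖ), Ab)` of additive functors. -/
abbrev ModFun := LFPMod R ⥤+ AddCommGrpCat.{u}

instance : EssentiallySmall.{u} (LFPMod R) := by
  have h : (fun M : ModuleCat.{u} R => Module.FinitePresentation R M) ≤ ModuleCat.isFG.{u} R :=
    fun M (_ : Module.FinitePresentation R M) => (inferInstance : Module.Finite R M)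
  have := (ObjectProperty.fullyFaithfulιOfLE h).full
  have := (ObjectProperty.fullyFaithfulιOfLE h).faithful
  exact essentiallySmall_of_fully_faithful (ObjectProperty.ιOfLE h)

variable {R}

/-- The subgroup of `X ⊗[ℤ] L` generated by the elements `(x · r) ⊗ l - x ⊗ (r · l)`. -/
def balancing (X : Type u) [AddCommGroup X] [Module Rᵐᵒᵖ X] (L : Type u) [AddCommGroup L]
    [Module R L] : AddSubgroup (X ⊗[ℤ] L) :=
  AddSubgroup.closure {z | ∃ (x : X) (r : R) (l : L),
    z = (MulOpposite.op r • x) ⊗ₜ[ℤ] l - x ⊗ₜ[ℤ] (r • l)}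

/-- The tensor product `X ⊗_R L` of a right module and a left module over a ring `R`. -/
abbrev BTensor (X : Type u) [AddCommGroup X] [Module Rᵐᵒᵖ X] (L : Type u) [AddCommGroup L]
    [Module R L] : Type u :=
  (X ⊗[ℤ] L) ⧸ balancing (R := R) X L

section

variable {X X' X'' : Type u} [AddCommGroup X] [Module Rᵐᵒᵖ X] [AddCommGroup X'] [Module Rᵐᵒᵖ X']
  [AddCommGroup X''] [Module Rᵐᵒᵖ X'']
  {L L' L'' : Type u} [AddCommGroup L] [Module R L] [AddCommGroup L'] [Module R L']
  [AddCommGroup L''] [Module R L'']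

/-- The pure tensor `x ⊗ l` in `X ⊗_R L`. -/
def btmul (x : X) (l : L) : BTensor (R := R) X L := QuotientAddGroup.mk (x ⊗ₜ[ℤ] l)

lemma btmul_smul (x : X) (r : R) (l : L) :
    btmul (R := R) (MulOpposite.op r • x) l = btmul x (r • l) :=
  (QuotientAddGroup.eq_iff_sub_mem).2 (AddSubgroup.subset_closure ⟨x, r, l, rfl⟩)

lemma btmul_add (x : X) (l l' : L) :
    btmul (R := R) x (l + l') = btmul x l + btmul x l' :=
  congrArg QuotientAddGroup.mk (TensorProduct.tmul_add x l l')

lemma add_btmul (x x' : X) (l : L) :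
    btmul (R := R) (x + x') l = btmul x l + btmul x' l :=
  congrArg QuotientAddGroup.mk (TensorProduct.add_tmul x x' l)

lemma BTensor.hom_ext {G : Type*} [AddCommGroup G] {φ ψ : BTensor (R := R) X L →+ G}
    (h : ∀ x l, φ (btmul x l) = ψ (btmul x l)) : φ = ψ := by
  ext z
  induction z using TensorProduct.induction_on with
  | zero => exact (map_zero φ).trans (map_zero ψ).symm
  | tmul x l => exact h x l
  | add a b ha hb =>
    refine (map_add φ (QuotientAddGroup.mk a) (QuotientAddGroup.mk b)).trans ?_
    exact (congrArg₂ (· + ·) ha hb).trans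
      (map_add ψ (QuotientAddGroup.mk a) (QuotientAddGroup.mk b)).symm

/-- The map `f ⊗ g` on tensor products. -/
def bmap (f : X →ₗ[Rᵐᵒᵖ] X') (g : L →ₗ[R] L') :
    BTensor (R := R) X L →+ BTensor (R := R) X' L' :=
  QuotientAddGroup.map _ _
    (TensorProduct.map f.toAddMonoidHom.toIntLinearMap g.toAddMonoidHom.toIntLinearMap).toAddMonoidHom
    (by
      refine (AddSubgroup.closure_le _).2 ?_
      rintro _ ⟨x, r, l, rfl⟩
      exact AddSubgroup.subset_closure ⟨f x, r, g l, by simp⟩)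

lemma bmap_btmul (f : X →ₗ[Rᵐᵒᵖ] X') (g : L →ₗ[R] L') (x : X) (l : L) :
    bmap f g (btmul x l) = btmul (f x) (g l) := rfl

end

/-- The functor `X ⊗ -` on finitely presented left modules. -/
def tensorObj (X : RMod R) : ModFun R :=
  ⟨{ obj := fun L => AddCommGrpCat.of (BTensor (R := R) X L.obj)
     map := fun g => AddCommGrpCat.ofHom (bmap LinearMap.id g.hom.hom)
     map_id := fun _ => AddCommGrpCat.hom_ext <| BTensor.hom_ext fun _ _ => rfl
     map_comp := fun _ _ => AddCommGrpCat.hom_ext <| BTensor.hom_ext fun _ _ => rfl },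
   ⟨fun {_ _ _ _} => AddCommGrpCat.hom_ext <| BTensor.hom_ext fun _ _ => btmul_add _ _ _⟩⟩

variable (R) in
/-- The tensor embedding `t : X ↦ X ⊗ -`. -/
def tensor : RMod R ⥤ ModFun R where
  obj X := tensorObj X
  map f := ObjectProperty.homMk
    { app := fun _ => AddCommGrpCat.ofHom (bmap f.hom LinearMap.id)
      naturality := fun _ _ _ => AddCommGrpCat.hom_ext <| BTensor.hom_ext fun _ _ => rfl }
  map_id _ := ObjectProperty.hom_ext _ <| NatTrans.ext <| funext fun _ =>
    AddCommGrpCat.hom_ext <| BTensor.hom_ext fun _ _ => rfl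
  map_comp _ _ := ObjectProperty.hom_ext _ <| NatTrans.ext <| funext fun _ =>
    AddCommGrpCat.hom_ext <| BTensor.hom_ext fun _ _ => rfl

instance : (tensor R).Additive where
  map_add {_ _ _ _} := ObjectProperty.hom_ext _ <| NatTrans.ext <| funext fun _ =>
    AddCommGrpCat.hom_ext <| BTensor.hom_ext fun _ _ => add_btmul _ _ _

variable (R) in
/-- The ring `R` as a finitely presented left module. -/
def ringObj : LFPMod R := ⟨ModuleCat.of R R, (inferInstance : Module.FinitePresentation R R)⟩

/-- Right multiplication by `r`, as an endomorphism of the left module `R`. -/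
def rightMul (r : R) : ringObj R ⟶ ringObj R :=
  ObjectProperty.homMk (ModuleCat.ofHom (LinearMap.toSpanSingleton R R r))

lemma rightMul_one : rightMul (1 : R) = 𝟙 _ := by
  ext; exact one_mul (1 : R)

lemma rightMul_mul (r s : R) : rightMul (r * s) = rightMul r ≫ rightMul s := by
  ext
  change (1 : R) * (r * s) = (1 * r) * s
  rw [mul_assoc]

lemma rightMul_add (r s : R) : rightMul (r + s) = rightMul r + rightMul s := by
  ext
  exact mul_add (1 : R) r s

/-- The abelian group `F(R)`. -/
def EvRing (F : ModFun R) : Type u := F.obj.obj (ringObj R)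

instance (F : ModFun R) : AddCommGroup (EvRing F) :=
  inferInstanceAs (AddCommGroup (F.obj.obj (ringObj R)))

/-- The right module structure on `F(R)`: `m · r` is the image of `m` under `F(- * r)`. -/
instance (F : ModFun R) : Module Rᵐᵒᵖ (EvRing F) where
  smul r m := F.obj.map (rightMul r.unop) m
  one_smul m := by
    change F.obj.map (rightMul 1) m = m
    rw [rightMul_one, F.obj.map_id]; rfl
  mul_smul r s m := by
    change F.obj.map (rightMul (s.unop * r.unop)) m = _
    rw [rightMul_mul, F.obj.map_comp]; rfl
  smul_zero r := map_zero (F.obj.map (rightMul r.unop)).hom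
  smul_add r m n := map_add (F.obj.map (rightMul r.unop)).hom m n
  add_smul r s m := by
    change F.obj.map (rightMul (r.unop + s.unop)) m = _
    rw [rightMul_add, F.obj.map_add]; rfl
  zero_smul m := by
    change F.obj.map (rightMul 0) m = 0
    have : rightMul (0 : R) = 0 := by
      ext
      exact mul_zero (1 : R)
    rw [this, F.obj.map_zero]; rfl

lemma EvRing.smul_def (F : ModFun R) (r : Rᵐᵒᵖ) (m : EvRing F) :
    r • m = (F.obj.map (rightMul r.unop) m : F.obj.obj (ringObj R)) := rfl

variable (R) in
/-- The evaluation functor `ev_R : F ↦ F(R)`. -/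
def evRing : ModFun R ⥤ RMod R where
  obj F := ModuleCat.of Rᵐᵒᵖ (EvRing F)
  map {F G} α := ModuleCat.ofHom (X := EvRing F) (Y := EvRing G)
    { toFun := fun m => α.hom.app (ringObj R) m
      map_add' := fun m n => map_add (α.hom.app (ringObj R)).hom m n
      map_smul' := fun r m =>
        ConcreteCategory.congr_hom (α.hom.naturality (rightMul r.unop)) m }

instance : (evRing R).Additive where

/-- The natural morphism `X ⟶ (X ⊗ -)(R)`, `x ↦ x ⊗ 1` (an isomorphism). -/
def toEvTensor (X : RMod R) : X ⟶ (evRing R).obj ((tensor R).obj X) :=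
  ModuleCat.ofHom (Y := EvRing ((tensor R).obj X))
    { toFun := fun x => btmul (R := R) (L := R) x (1 : R)
      map_add' := fun x y => add_btmul x y _
      map_smul' := fun r x => by
        refine (btmul_smul (L := R) x r.unop (1 : R)).trans ?_
        change _ = btmul (R := R) (L := R) x ((1 : R) * r.unop)
        simp }

lemma toEvTensor_naturality {X Y : RMod R} (f : X ⟶ Y) :
    f ≫ toEvTensor Y = toEvTensor X ≫ (evRing R).map ((tensor R).map f) := rfl

end Tensor
end AGJ
namespace AGJ

section Recollement

variable (R : Type u) [Ring R]

/-- The Auslander–Gruson–Jensen functor `D_A = R₀(t ∘ w)`. It is contravariant, written here as a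
covariant functor to the opposite category; the zeroth right derived functor of the contravariant
functor `t ∘ w` (computed from projective resolutions) thereby becomes the zeroth left derived
functor of `w ⋙ t.op`. -/
noncomputable def DA : FP (RMod R) ⥤ (ModFun R)ᵒᵖ :=
  (w (RMod R) ⋙ (tensor R).op).leftDerived 0

/-- The functor `D_L = L⁰(Y ∘ ev_R)`: the zeroth left derived functor of the contravariant functor
`Y ∘ ev_R`, computed from injective resolutions in `(mod(Rᵒᵖ), Ab)`, which are
projective resolutions in the opposite category. -/
noncomputable def DL : (ModFun R)ᵒᵖ ⥤ FP (RMod R) :=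
  ((evRing R).op ⋙ yonedaFP (RMod R)).leftDerived 0

variable {R}

/-- The canonical morphism `D_A(X, -) ⟶ X ⊗ -` in the opposite category (an isomorphism). -/
noncomputable def DAyoneda (X : RMod R) :
    (DA R).obj ((yonedaFP (RMod R)).obj (op X)) ⟶ op ((tensor R).obj X) :=
  (w (RMod R) ⋙ (tensor R).op).fromLeftDerivedZero.app _ ≫
    (tensor R).op.map ((wAdjunction (RMod R)).counit.app (op X))

/-- The natural transformation `γ_(X, -) : D_L D_A (X, -) ⟶ (X, -)`, obtained by evaluating the
canonical morphism `L⁰(Y ∘ ev_R) ⟶ Y ∘ ev_R` at `X ⊗ -`. -/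
noncomputable def gammaYoneda (X : RMod R) :
    (DL R).obj ((DA R).obj ((yonedaFP (RMod R)).obj (op X))) ⟶ (yonedaFP (RMod R)).obj (op X) :=
  (DL R).map (DAyoneda X) ≫
    ((evRing R).op ⋙ yonedaFP (RMod R)).fromLeftDerivedZero.app (op ((tensor R).obj X)) ≫
    (yonedaFP (RMod R)).map (toEvTensor X).op

lemma DAyoneda_naturality {X Y : RMod R} (f : X ⟶ Y) :
    (DA R).map ((yonedaFP (RMod R)).map f.op) ≫ DAyoneda X =
      DAyoneda Y ≫ ((tensor R).map f).op := by
  have h1 := (w (RMod R) ⋙ (tensor R).op).fromLeftDerivedZero.naturality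
    ((yonedaFP (RMod R)).map f.op)
  have h2 := (wAdjunction (RMod R)).counit.naturality f.op
  unfold DAyoneda DA
  rw [reassoc_of% h1, Category.assoc]
  refine congrArg (_ ≫ ·) ?_
  exact ((tensor R).op.map_comp _ _).symm.trans ((congrArg (tensor R).op.map h2).trans
    ((tensor R).op.map_comp _ _))

lemma gammaYoneda_naturality {X Y : RMod R} (f : X ⟶ Y) :
    (DL R).map ((DA R).map ((yonedaFP (RMod R)).map f.op)) ≫ gammaYoneda X =
      gammaYoneda Y ≫ (yonedaFP (RMod R)).map f.op := by
  have h1 := ((evRing R).op ⋙ yonedaFP (RMod R)).fromLeftDerivedZero.naturality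
    ((tensor R).map f).op
  have h2 := DAyoneda_naturality f
  have h3 : (yonedaFP (RMod R)).map ((evRing R).map ((tensor R).map f)).op ≫
      (yonedaFP (RMod R)).map (toEvTensor X).op =
      (yonedaFP (RMod R)).map (toEvTensor Y).op ≫ (yonedaFP (RMod R)).map f.op := by
    rw [← Functor.map_comp, ← Functor.map_comp, ← op_comp, ← op_comp, toEvTensor_naturality]
  have h4 : (((evRing R).op ⋙ yonedaFP (RMod R)).leftDerived 0).map ((tensor R).map f).op ≫
      ((evRing R).op ⋙ yonedaFP (RMod R)).fromLeftDerivedZero.app (op ((tensor R).obj X)) ≫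
        (yonedaFP (RMod R)).map (toEvTensor X).op =
      ((evRing R).op ⋙ yonedaFP (RMod R)).fromLeftDerivedZero.app (op ((tensor R).obj Y)) ≫
        (yonedaFP (RMod R)).map (toEvTensor Y).op ≫ (yonedaFP (RMod R)).map f.op := by
    rw [← h3, reassoc_of% h1]
    rfl
  have h5 : gammaYoneda Y ≫ (yonedaFP (RMod R)).map f.op = (DL R).map (DAyoneda Y) ≫
      (((evRing R).op ⋙ yonedaFP (RMod R)).fromLeftDerivedZero.app (op ((tensor R).obj Y)) ≫
        (yonedaFP (RMod R)).map (toEvTensor Y).op ≫ (yonedaFP (RMod R)).map f.op) := by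
    unfold gammaYoneda
    rw [Category.assoc]
    exact congrArg ((DL R).map (DAyoneda Y) ≫ ·) (Category.assoc _ _ _)
  have h6 : (DL R).map ((DA R).map ((yonedaFP (RMod R)).map f.op)) ≫ gammaYoneda X =
      (DL R).map (DAyoneda Y) ≫ ((DL R).map ((tensor R).map f).op ≫
        (((evRing R).op ⋙ yonedaFP (RMod R)).fromLeftDerivedZero.app (op ((tensor R).obj X)) ≫
          (yonedaFP (RMod R)).map (toEvTensor X).op)) := by
    unfold gammaYoneda
    rw [← Functor.map_comp_assoc, h2, Functor.map_comp_assoc]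
  rw [h5, h6]
  exact congrArg ((DL R).map (DAyoneda Y) ≫ ·) h4

lemma DLDA_map_epi {F G : FP (RMod R)} (p : F ⟶ G) [Epi p] :
    Epi ((DL R).map ((DA R).map p)) := by
  have : Epi ((DA R).map p) := leftDerivedZero_map_epi _ p
  exact leftDerivedZero_map_epi _ _

lemma exists_DLDA_desc {F G H : FP (RMod R)} (f : F ⟶ G) (e : G ⟶ H) [Epi e] (hw : f ≫ e = 0)
    (hex : (ShortComplex.mk f e hw).Exact) {Z : FP (RMod R)}
    (h : (DL R).obj ((DA R).obj G) ⟶ Z) (hh : (DL R).map ((DA R).map f) ≫ h = 0) :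
    ∃ k, (DL R).map ((DA R).map e) ≫ k = h := by
  have he : Epi ((DA R).map e) := leftDerivedZero_map_epi _ e
  have hadd : (DA R).Additive :=
    inferInstanceAs ((w (RMod R) ⋙ (tensor R).op).leftDerived 0).Additive
  have hw' : (DA R).map f ≫ (DA R).map e = 0 := by
    rw [← Functor.map_comp, hw, Functor.map_zero]
  have hd : ∀ {T : (ModFun R)ᵒᵖ} (g : (DA R).obj G ⟶ T) (_ : (DA R).map f ≫ g = 0),
      ∃ k, (DA R).map e ≫ k = g := fun g hg => exists_leftDerivedZero_desc _ f e hw hex g hg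
  have hex' : (ShortComplex.mk ((DA R).map f) ((DA R).map e) hw').Exact :=
    ShortComplex.exact_of_g_is_cokernel _ (CokernelCofork.IsColimit.ofπ _ _
      (fun g hg => (hd g hg).choose) (fun g hg => (hd g hg).choose_spec)
      (fun g hg m hm => by
        rw [← cancel_epi ((DA R).map e)]
        exact hm.trans (hd g hg).choose_spec.symm))
  exact exists_leftDerivedZero_desc _ _ _ hw' hex' h hh

/-- There is exactly one `γ_F` making the square with `γ_(X, -)` commute for every
`(X, -) ⟶ F`. -/
lemma existsUnique_gamma (F : FP (RMod R)) :
    ∃! g : (DL R).obj ((DA R).obj F) ⟶ F,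
      ∀ (X : RMod R) (p : (yonedaFP (RMod R)).obj (op X) ⟶ F),
        (DL R).map ((DA R).map p) ≫ g = gammaYoneda X ≫ p := by
  obtain ⟨X, p, _⟩ := exists_epi_yonedaFP F
  obtain ⟨Y, q, _⟩ := exists_epi_yonedaFP (kernel p)
  have hw : (q ≫ kernel.ι p) ≫ p = 0 := by simp
  have hex : (ShortComplex.mk _ p hw).Exact := ShortComplex.exact_of_g_is_cokernel _
    (isCokernelEpiComp (Abelian.epiIsCokernelOfKernel _ (kernelIsKernel p)) q rfl)
  have hnat : ∀ {X Y : RMod R} (f : (yonedaFP (RMod R)).obj (op Y) ⟶ (yonedaFP (RMod R)).obj (op X)),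
      (DL R).map ((DA R).map f) ≫ gammaYoneda X = gammaYoneda Y ≫ f := fun f => by
    obtain ⟨g, rfl⟩ := (yonedaFP (RMod R)).map_surjective f
    exact gammaYoneda_naturality g.unop
  have hp := DLDA_map_epi p
  obtain ⟨g, hg⟩ := exists_DLDA_desc _ p hw hex (gammaYoneda X ≫ p) (by
    rw [← Category.assoc, hnat, Category.assoc, hw, comp_zero])
  refine ⟨g, fun X' p' => ?_, fun g' hg' => ?_⟩
  · have h1 : p' = Projective.factorThru p' p ≫ p := (Projective.factorThru_comp p' p).symm
    rw [h1, Functor.map_comp, Functor.map_comp, Category.assoc, hg, ← Category.assoc, hnat,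
      Category.assoc]
  · rw [← cancel_epi ((DL R).map ((DA R).map p)), hg, hg']

/-- The morphism `γ_F : D_L D_A F ⟶ F`: for every presentation `(Y, -) ⟶ (X, -) ⟶ F ⟶ 0` with last
map `p`, it is the morphism induced on cokernels by `γ_(Y, -)` and `γ_(X, -)`, i.e.
`D_L D_A (p) ≫ γ_F = γ_(X, -) ≫ p`. -/
noncomputable def gamma (F : FP (RMod R)) : (DL R).obj ((DA R).obj F) ⟶ F :=
  (existsUnique_gamma F).choose

lemma map_comp_gamma {F : FP (RMod R)} {X : RMod R} (p : (yonedaFP (RMod R)).obj (op X) ⟶ F) :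
    (DL R).map ((DA R).map p) ≫ gamma F = gammaYoneda X ≫ p :=
  (existsUnique_gamma F).choose_spec.1 X p

lemma gamma_yoneda (X : RMod R) : gamma ((yonedaFP (RMod R)).obj (op X)) = gammaYoneda X := by
  have := map_comp_gamma (𝟙 ((yonedaFP (RMod R)).obj (op X)))
  simpa using this

lemma gamma_naturality {F G : FP (RMod R)} (α : F ⟶ G) :
    (DL R).map ((DA R).map α) ≫ gamma G = gamma F ≫ α := by
  obtain ⟨X, p, _⟩ := exists_epi_yonedaFP F
  have hp := DLDA_map_epi p
  rw [← cancel_epi ((DL R).map ((DA R).map p)), ← Functor.map_comp_assoc, ← Functor.map_comp,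
    map_comp_gamma, ← Category.assoc ((DL R).map _) (gamma F) α, map_comp_gamma, Category.assoc]

variable (R) in
/-- The functor `F ↦ F^p = coker(γ_F)` from `fp(Mod(R), Ab)` to itself. -/
noncomputable def upperP : FP (RMod R) ⥤ FP (RMod R) where
  obj F := cokernel (gamma F)
  map {F G} α := cokernel.map (gamma F) (gamma G) ((DL R).map ((DA R).map α)) α
    (gamma_naturality α).symm
  map_id F := by
    rw [← cancel_epi (cokernel.π (gamma F))]
    simp [cokernel.map]
  map_comp {F G H} α β := by
    rw [← cancel_epi (cokernel.π (gamma F))]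
    simp [cokernel.map]

/-- The projection `F ⟶ F^p`. -/
noncomputable def toUpperP (F : FP (RMod R)) : F ⟶ (upperP R).obj F := cokernel.π (gamma F)

end Recollement
end AGJ

namespace AGJ

/-! The functor `DA` is written with values in the opposite category, so it preserves epimorphisms,
and a monomorphism of functors on modules becomes an epimorphism there. The whole statement rests on
two facts: `DA` sends every `gamma F` to an epimorphism, and `gamma` is natural. Neither an
adjunction between `DA` and `DL` nor invertibility of `DA` on `gamma` is needed.

For the first fact, take F = (X,-) and embed X ⊗ - in an injective I⁰ by i. The map (I⁰(R),-) ⟶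
D_L(X ⊗ -), followed by `gammaYoneda X` (up to D_A(X,-) ≅ X ⊗ -), is precomposition with X ⟶ I⁰(R).
`DA` turns it into the induced map X ⊗ - ⟶ I⁰(R) ⊗ -, reversed. That map is mono because i factors
through it, via m ⊗ l ↦ I⁰(- · l)(m) (`mono_tensor_map_evRing`). So `DA` of the composite is epi,
hence so is `DA` of its last factor (`epi_DA_map_gammaYoneda`). A general F is a quotient of a
representable, and the property passes to quotients (`epi_DA_map_gamma`).

Then D_A of the projection F ⟶ F^p is both epi and zero, so D_A(F^p) = 0 (`kernel_DA_upperP`).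
Conversely, if D_A G = 0, naturality makes γ_F followed by F ⟶ G factor through D_L D_A G = 0, so
every F ⟶ G factors uniquely through the cokernel (`gamma_comp_eq_zero`). -/

section

variable {R : Type u} [Ring R]

/-! ### Comparing a functor F with F(R) ⊗ - -/

/-- The morphism `R ⟶ L`, `r ↦ r • l`. -/
def ofElement {L : LFPMod R} (l : L.obj) : ringObj R ⟶ L :=
  ObjectProperty.homMk (ModuleCat.ofHom (LinearMap.toSpanSingleton R L.obj l))

/-- The natural map `F(R) ⊗ L ⟶ F(L)`, `m ⊗ l ↦ F(- · l)(m)`. -/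
def evTensorDesc (F : ModFun R) (L : LFPMod R) :
    BTensor (R := R) (EvRing F) L.obj →+ F.obj.obj L :=
  -- A left-linear map out of R is determined by its value at 1, so here and in `hsmul` only that
  -- value has to be compared.
  have hadd (l l' : L.obj) : ofElement (l + l') = ofElement l + ofElement l' := by
    ext
    exact smul_add (1 : R) l l'
  have hsmul (r : R) (l : L.obj) : rightMul r ≫ ofElement l = ofElement (r • l) := by
    ext
    change ((1 : R) * r) • l = (1 : R) • r • l
    rw [mul_smul]
  let b : EvRing F →+ L.obj →+ F.obj.obj L := AddMonoidHom.mk'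
    (fun m => AddMonoidHom.mk' (fun l => F.obj.map (ofElement l) m) fun l l' => by
      rw [hadd, F.obj.map_add]; rfl)
    fun m m' => AddMonoidHom.ext fun l => map_add (F.obj.map (ofElement l)).hom m m'
  QuotientAddGroup.lift _ (TensorProduct.liftAddHom b fun n m l => by
      rw [map_zsmul, map_zsmul]; rfl) <| by
    -- The pairing must kill the balancing relations. On a generator this is functoriality of F:
    -- acting by r and then by l is acting by r • l, which is `hsmul`.
    refine (AddSubgroup.closure_le _).2 ?_
    rintro _ ⟨m, r, l, rfl⟩
    refine (map_sub _ _ _).trans (sub_eq_zero.2 ?_)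
    change F.obj.map (ofElement l) (F.obj.map (rightMul r) m) = F.obj.map (ofElement (r • l)) m
    rw [← hsmul, F.obj.map_comp]
    rfl

/-- A monomorphism `X ⊗ - ⟶ F` factors through the map `X ⊗ - ⟶ F(R) ⊗ -` it induces. -/
lemma mono_tensor_map_evRing {X : RMod R} {F : ModFun R} (i : (tensor R).obj X ⟶ F) [Mono i] :
    Mono ((tensor R).map (toEvTensor X ≫ (evRing R).map i)) := by
  set f := (tensor R).map (toEvTensor X ≫ (evRing R).map i)
  -- Since x ⊗ l is the image of x ⊗ 1 under the map R ⟶ L with 1 ↦ l, naturality of i at that map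
  -- gives the factorization. It is needed only at each L separately, so naturality of
  -- `evTensorDesc` in L plays no role.
  have key (L : LFPMod R) :
      (evTensorDesc F L).comp (f.hom.app L).hom = (i.hom.app L).hom := by
    refine BTensor.hom_ext (X := X) (L := L.obj) fun x l => ?_
    refine (ConcreteCategory.congr_hom (i.hom.naturality (ofElement l))
      (btmul (R := R) (L := R) x (1 : R))).symm.trans ?_
    refine congrArg (i.hom.app L) ?_
    change btmul (R := R) x ((1 : R) • l) = btmul (R := R) x l
    rw [one_smul]
  have : Mono f.hom := by
    rw [NatTrans.mono_iff_mono_app]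
    intro L
    have := mono_app i L
    have h := (AddCommGrpCat.mono_iff_injective (i.hom.app L)).1 inferInstance
    rw [AddCommGrpCat.mono_iff_injective]
    refine Function.Injective.of_comp (f := evTensorDesc F L) ?_
    have hk : (evTensorDesc F L) ∘ (f.hom.app L) = i.hom.app L :=
      funext fun x => DFunLike.congr_fun (key L) x
    exact hk ▸ h
  -- The inclusion of additive functors into all functors is faithful, so it reflects monomorphisms.
  exact (additiveFunctor (LFPMod R) AddCommGrpCat.{u}).ι.mono_of_mono_map this

/-! ### `DA` sends the morphisms γ to epimorphisms -/

/-- Representables are projective, so there the zeroth derived functor agrees with the original one;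
and the counit of `wAdjunction` is invertible because the Yoneda embedding is fully faithful. -/
instance isIso_DAyoneda (X : RMod R) : IsIso (DAyoneda X) := by
  have h1 : IsIso ((w (RMod R) ⋙ (tensor R).op).fromLeftDerivedZero.app
    ((yonedaFP (RMod R)).obj (op X))) := inferInstance
  have h2 : IsIso ((tensor R).op.map ((wAdjunction (RMod R)).counit.app (op X))) := inferInstance
  exact IsIso.comp_isIso' h1 h2

/-- By naturality of the isomorphisms `DAyoneda`, the morphism in question is the opposite of f ⊗ -
up to isomorphism. -/
lemma epi_DA_map_yonedaFP {X Y : RMod R} (f : X ⟶ Y) [Mono ((tensor R).map f)] :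
    Epi ((DA R).map ((yonedaFP (RMod R)).map f.op)) := by
  have h : (DA R).map ((yonedaFP (RMod R)).map f.op) =
      DAyoneda Y ≫ ((tensor R).map f).op ≫ inv (DAyoneda X) := by
    rw [← Category.assoc, IsIso.eq_comp_inv]
    exact DAyoneda_naturality f
  rw [h]
  infer_instance

/-- It suffices to find a morphism into the source of γ whose composite with γ becomes epi under
`DA`. The first term of an injective resolution of X ⊗ - supplies one. -/
lemma epi_DA_map_gammaYoneda (X : RMod R) : Epi ((DA R).map (gammaYoneda X)) := by
  let G := (evRing R).op ⋙ yonedaFP (RMod R)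
  -- A projective resolution in the opposite category is an injective coresolution of X ⊗ -: its
  -- degree-zero term is I⁰, and its augmentation is the embedding i of X ⊗ - in I⁰.
  let P := projectiveResolution (op ((tensor R).obj X))
  let i : (tensor R).obj X ⟶ (P.complex.X 0).unop := (aug P).unop
  have : Mono i := inferInstanceAs (Mono (aug P).unop)
  have := mono_tensor_map_evRing i
  let t : G.obj (P.complex.X 0) ⟶ (DL R).obj (op ((tensor R).obj X)) := toLeftDerivedZero G P
  have ht : t ≫ G.fromLeftDerivedZero.app (op ((tensor R).obj X)) =
      (yonedaFP (RMod R)).map ((evRing R).map i).op := toLeftDerivedZero_comp G P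
  -- The inverse cancels the first factor of `gammaYoneda X`; what remains is a morphism of
  -- representables, induced by X ≅ X ⊗ R ⟶ I⁰(R).
  have h : (t ≫ inv ((DL R).map (DAyoneda X))) ≫ gammaYoneda X =
      (yonedaFP (RMod R)).map (toEvTensor X ≫ (evRing R).map i).op := by
    unfold gammaYoneda
    rw [Category.assoc, IsIso.inv_hom_id_assoc, op_comp, Functor.map_comp, ← ht]
    exact (Category.assoc _ _ _).symm
  have h' : Epi ((DA R).map ((t ≫ inv ((DL R).map (DAyoneda X))) ≫ gammaYoneda X)) :=
    h ▸ epi_DA_map_yonedaFP _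
  rw [Functor.map_comp] at h'
  exact epi_of_epi ((DA R).map (t ≫ inv ((DL R).map (DAyoneda X))))
    ((DA R).map (gammaYoneda X))

/-- Choose an epimorphism p from (X,-) to F. In the square defining γ_F, the path through γ_(X,-)
and p is epi after `DA`, and γ_F is the last factor of the other path. -/
lemma epi_DA_map_gamma (F : FP (RMod R)) : Epi ((DA R).map (gamma F)) := by
  obtain ⟨X, p, _⟩ := exists_epi_yonedaFP F
  have hp : Epi ((DA R).map p) := leftDerivedZero_map_epi _ p
  have hX := epi_DA_map_gammaYoneda X
  have h : Epi ((DA R).map (gammaYoneda X ≫ p)) := by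
    rw [Functor.map_comp]
    exact epi_comp _ _
  rw [← map_comp_gamma, Functor.map_comp] at h
  exact epi_of_epi ((DA R).map ((DL R).map ((DA R).map p))) ((DA R).map (gamma F))

/-! ### F^p lies in ker(D_A), and its universal property -/

instance : (DA R).Additive :=
  inferInstanceAs ((w (RMod R) ⋙ (tensor R).op).leftDerived 0).Additive

instance : (DL R).Additive :=
  inferInstanceAs (((evRing R).op ⋙ yonedaFP (RMod R)).leftDerived 0).Additive

/-- D_A(π) vanishes because it does so after the epimorphism D_A(γ_F). But D_A(π) is itself epi, and
a zero epimorphism has zero target. -/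
lemma kernel_DA_upperP (F : FP (RMod R)) : (DA R).kernel ((upperP R).obj F) := by
  have hγ := epi_DA_map_gamma F
  have hπ : Epi ((DA R).map (cokernel.π (gamma F))) := leftDerivedZero_map_epi _ _
  have h0 : (DA R).map (cokernel.π (gamma F)) = 0 := by
    rw [← cancel_epi ((DA R).map (gamma F)), ← Functor.map_comp, cokernel.condition,
      Functor.map_zero, comp_zero]
  refine (IsZero.iff_id_eq_zero ((DA R).obj (cokernel (gamma F)))).2 ?_
  rw [← cancel_epi ((DA R).map (cokernel.π (gamma F))), h0, zero_comp, zero_comp]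

/-- By naturality of γ the composite is D_L D_A(f) followed by γ_G, and D_A(f) has zero target. This
is what makes f descend to the cokernel F^p. -/
lemma gamma_comp_eq_zero {F G : FP (RMod R)} (hG : (DA R).kernel G) (f : F ⟶ G) :
    gamma F ≫ f = 0 := by
  have hG' : IsZero ((DA R).obj G) := hG
  rw [← gamma_naturality, hG'.eq_of_tgt ((DA R).map f) 0, Functor.map_zero, zero_comp]

lemma toUpperP_naturality {F G : FP (RMod R)} (f : F ⟶ G) :
    toUpperP F ≫ (upperP R).map f = f ≫ toUpperP G :=
  cokernel.π_desc _ _ _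

instance (F : FP (RMod R)) : Epi (toUpperP F) :=
  inferInstanceAs (Epi (cokernel.π (gamma F)))

/-- Composition with `F ⟶ F^p` is a bijection onto the morphisms to an object of `ker(D_A)`. -/
noncomputable def upperPHomEquiv (F : FP (RMod R)) {G : FP (RMod R)} (hG : (DA R).kernel G) :
    ((upperP R).obj F ⟶ G) ≃ (F ⟶ G) where
  toFun g := toUpperP F ≫ g
  invFun f := cokernel.desc (gamma F) f (gamma_comp_eq_zero hG f)
  left_inv _ := (cancel_epi (toUpperP F)).1 (cokernel.π_desc _ _ _)
  right_inv _ := cokernel.π_desc _ _ _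

variable (R) in
/-- The functor `F ↦ F^p` is left adjoint to the inclusion of `ker(D_A)`. -/
noncomputable def upperPAdjunction :
    (DA R).kernel.lift (upperP R) kernel_DA_upperP ⊣ (DA R).kernel.ι :=
  Adjunction.mkOfHomEquiv
    -- The subcategory is full, so its morphisms F^p ⟶ G are exactly the natural transformations.
    { homEquiv F G := (ObjectProperty.fullyFaithfulι _).homEquiv.trans
        (upperPHomEquiv F G.property)
      homEquiv_naturality_left_symm {F F' G} f g := by
        rw [Equiv.symm_apply_eq]
        change f ≫ g = toUpperP F ≫ (upperP R).map f ≫ (upperPHomEquiv F' G.property).symm g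
        rw [← Category.assoc, toUpperP_naturality, Category.assoc]
        exact congrArg (f ≫ ·) ((upperPHomEquiv F' G.property).apply_symm_apply g).symm
      homEquiv_naturality_right {F G G'} f g := (Category.assoc (toUpperP F) f.hom g.hom).symm }

end

end AGJ

/-- The hom bijection of an adjunction is composition with its unit, so prescribing the unit forces
the natural bijection to be composition with F ⟶ F^p. -/
theorem mainTheorem7 (R : Type u) [Ring R] :
    ∃ hp : ∀ F : AGJ.FP (AGJ.RMod R), (AGJ.DA R).kernel ((AGJ.upperP R).obj F),
      ∃ adj : (AGJ.DA R).kernel.lift (AGJ.upperP R) hp ⊣ (AGJ.DA R).kernel.ι,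
        ∀ F : AGJ.FP (AGJ.RMod R), adj.unit.app F = AGJ.toUpperP F := by
  refine ⟨AGJ.kernel_DA_upperP, AGJ.upperPAdjunction R, fun F => ?_⟩
  -- The unit is the image of the identity of F^p under the hom bijection, that is, the projection
  -- followed by an identity.
  refine (CategoryTheory.Adjunction.mkOfHomEquiv_unit_app _ _).trans ?_
  exact Category.comp_id (AGJ.toUpperP F)
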